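/- **Feature hashing preserves inner products.** For $m\ge 1$ let $h:\mathbb N\to\{1,\dots,m\}$ and $\xi:\mathbb N\to\{\pm1\}$ be random hash functions: the values $h(j)$ are uniform on $\{1,\dots,m\}$, the values $\xi(j)$ are uniform on $\{\pm1\}$, and all of them are independent. For real $x,x'\in\ell_2$ define the hashed feature map $\phi(x)\in\mathbb R^m$ by $$\phi_i(x)=\sum_{j:\,h(j)=i}\xi(j)\,x_j ,\qquad i=1,\dots,m,$$ the series being summed in the natural order of $j$, and the hashed inner product by $\langle x,x'\rangle_\phi=\langle\phi(x),\phi(x')\rangle$. Let $$\eta=\max\Bigl(\frac{\|x\|_\infty}{\|x\|_2},\frac{\|x'\|_\infty}{\|x'\|_2},\frac{\|x-x'\|_\infty}{\|x-x'\|_2}\Bigr),\qquad \Delta=\|x\|_2^2+\|x'\|_2^2+\|x-x'\|_2^2,$$ where a ratio $0/0$ is read as $0$. For every $\delta_0\in(0,1)$ there are constants $C,c>0$, depending only on $\delta_0$, such that for all integers $m\ge1$, all $\varepsilon\in(0,1)$, all $\delta\in(0,\delta_0]$ and all $x,x'\in\ell_2$ with $$m\ \ge\ C\,\frac{\log(1/\delta)}{\varepsilon^2}\qquad\text{and}\qquad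 \eta\ \le\ c\,\frac{\varepsilon}{\log(m/\delta)},$$ the series defining $\phi(x)$ and $\phi(x')$ converge almost surely, and $$\Pr\Bigl[\,\bigl|\langle x,x'\rangle_\phi-\langle x,x'\rangle\bigr|>\tfrac{\varepsilon\Delta}{2}\Bigr]<\delta .$$ (In particular, with $\delta_0=1/2$, the constants are absolute for all $\delta\le 1/2$.) -/

import Mathlib

open MeasureTheory ProbabilityTheory Filter Topology

/-- Partial sums `∑_{j < N, h j = i} ξ(j) x_j` of the series defining coordinate `i` of the
hashed feature map. -/
noncomputable def hashPartialSum {m : ℕ} (h : ℕ → Fin m) (ξ : ℕ → ℤˣ)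
    (x : lp (fun _ : ℕ => ℝ) 2) (i : Fin m) (N : ℕ) : ℝ :=
  ∑ j ∈ Finset.range N with h j = i, ((ξ j : ℤ) : ℝ) * x j

/-- The hashed feature map `φ^{(h,ξ)} : ℓ² → ℝ^m`, with coordinates
`φ_i(x) = ∑_{j : h j = i} ξ(j) x_j`. A square summable sequence need not be absolutely summable,
so the series is summed in the natural order of `ℕ` (an unordered sum would not exist); on
finitely supported `x` this is just a finite sum. -/
noncomputable def hashMap {m : ℕ} (h : ℕ → Fin m) (ξ : ℕ → ℤˣ)
    (x : lp (fun _ : ℕ => ℝ) 2) : EuclideanSpace ℝ (Fin m) :=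
  WithLp.toLp 2 fun i => limUnder atTop (hashPartialSum h ξ x i)

/-- The hashed inner product `⟨x, x'⟩_φ = ⟨φ(x), φ(x')⟩`. -/
noncomputable def hashInner {m : ℕ} (h : ℕ → Fin m) (ξ : ℕ → ℤˣ)
    (x x' : lp (fun _ : ℕ => ℝ) 2) : ℝ :=
  inner ℝ (hashMap h ξ x) (hashMap h ξ x')

/-- The law of a random pair `(h, ξ)`: the values `h(j)` are uniform on the `m` buckets, the values
`ξ(j)` are uniform on `{±1}`, and all of them are independent. -/
noncomputable def hashLaw (m : ℕ) [NeZero m] : Measure ((ℕ → Fin m) × (ℕ → ℤˣ)) :=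
  (Measure.infinitePi fun _ : ℕ => uniformOn (Set.univ : Set (Fin m))).prod
    (Measure.infinitePi fun _ : ℕ => uniformOn (Set.univ : Set ℤˣ))

/-- Every subset of `{±1}` is measurable. -/
instance : MeasurableSingletonClass ℤˣ where
  measurableSet_singleton u :=
    ⟨{(u : ℤ)}, measurableSet_singleton _, by ext v; simp [Units.ext_iff]⟩

instance (m : ℕ) [NeZero m] : IsProbabilityMeasure (hashLaw m) := by
  unfold hashLaw; infer_instance

/-- The ratio `‖x‖_∞ / ‖x‖₂`, which is `0` for `x = 0`. -/
noncomputable def supRatio (x : lp (fun _ : ℕ => ℝ) 2) : ℝ :=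
  (⨆ j, |x j|) / ‖x‖

/-- `η`, the largest of the ratios `‖·‖_∞ / ‖·‖₂` of `x`, `x'` and `x - x'`. -/
noncomputable def maxRatio (x x' : lp (fun _ : ℕ => ℝ) 2) : ℝ :=
  max (supRatio x) (max (supRatio x') (supRatio (x - x')))

/-!
By the polarization identity `2 ⟨x, x'⟩ = ‖x‖² + ‖x'‖² - ‖x - x'‖²`, valid for the hashed vectors too,
it is enough that hashing distorts the squared norm of each of the three vectors by a factor at most
`1 ± ε`, with failure probability `δ / 4` (`hashLaw_norm_tail_le`).

For one vector `x`, let `S_i` be the mass `∑_{h j = i} x_j²` of bucket `i` (`bucketMass`). Fix the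
buckets first. Averaging over the signs one coordinate at a time gives
`E exp (± l (‖φ(x)‖² - ‖x‖²)) ≤ exp (2 l² ∑ S_i²)` as long as `l S_i ≤ 1 / 8` for all `i`
(`lintegral_exp_sum_sq_le`). Since `∑ S_i² ≤ (max S_i) ‖x‖²`, taking `l` of order
`log (1 / δ) / (ε ‖x‖²)` yields the tail bound whenever `max S_i` is at most a small multiple of
`ε² ‖x‖² / log (1 / δ)`. Over the choice of the buckets, `S_i` has mean `‖x‖² / m`, which the lower
bound on `m` makes small, and is a sum of independent terms of size at most `‖x‖_∞²`; the bound on `η`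
therefore lets Chernoff's inequality (`bucketLaw_mass_tail_le`) and a union bound over the `m` buckets
control `max S_i`.

The estimates are made for the truncations to the first `N` coordinates. The series converge almost
surely by martingale convergence (`ae_exists_tendsto_sum_of_iIndepFun`), and Fatou's lemma carries the
tail bound to the limit.
-/

/-! ### Random series of independent terms -/

/-- A series of independent centered random variables with summable variances converges almost
surely: its partial sums are a martingale bounded in `L²`. -/
theorem ae_exists_tendsto_sum_of_iIndepFun {Ω : Type*} {mΩ : MeasurableSpace Ω} {μ : Measure Ω}
    [IsProbabilityMeasure μ] {X : ℕ → Ω → ℝ} (hmeas : ∀ j, StronglyMeasurable (X j))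
    (hL : ∀ j, MemLp (X j) 2 μ) (hind : iIndepFun X μ) (hmean : ∀ j, μ[X j] = 0)
    (hvar : Summable fun j => Var[X j; μ]) :
    ∀ᵐ ω ∂μ, ∃ l, Tendsto (fun N => ∑ j ∈ Finset.range N, X j ω) atTop (𝓝 l) := by
  -- The sums are shifted by one so that `f N` is adapted to the natural filtration of `X` at `N`.
  set f : ℕ → Ω → ℝ := fun N => ∑ j ∈ Finset.range (N + 1), X j with hf
  have hfL : ∀ N, MemLp (f N) 2 μ := fun N => memLp_finsetSum' _ fun j _ => hL j
  have hmart : Martingale f (Filtration.natural X hmeas) μ := by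
    refine martingale_of_condExp_sub_eq_zero_nat ?_ (fun N => (hfL N).integrable one_le_two) ?_
    · intro N
      refine Finset.stronglyMeasurable_sum _ fun j hj => ?_
      exact ((Filtration.stronglyAdapted_natural hmeas) j).mono
        ((Filtration.natural X hmeas).mono (by simpa [Nat.lt_succ_iff] using hj))
    · intro N
      have h1 : f (N + 1) - f N = X (N + 1) := by
        simp [hf, Finset.sum_range_succ _ (N + 1)]
      rw [h1]
      refine (hind.condExp_natural_ae_eq_of_lt hmeas (Nat.lt_succ_self N)).trans ?_
      rw [hmean]; rfl
  have hbdd : ∀ N, eLpNorm (f N) 1 μ ≤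
      ((Real.sqrt (∑' j, Var[X j; μ])).toNNReal : ENNReal) := by
    intro N
    refine (eLpNorm_le_eLpNorm_of_exponent_le one_le_two (hfL N).aestronglyMeasurable).trans ?_
    have hm0 : μ[f N] = 0 := by
      have : μ[f N] = ∑ j ∈ Finset.range (N + 1), μ[X j] := by
        rw [← integral_finsetSum _ fun j _ => (hL j).integrable one_le_two]
        simp [hf]
      simp [this, hmean]
    have h2 : ∫ ω, f N ω ^ 2 ∂μ ≤ ∑' j, Var[X j; μ] := by
      rw [← variance_of_integral_eq_zero (hfL N).aestronglyMeasurable.aemeasurable hm0, hf,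
        IndepFun.variance_sum (fun j _ => hL j) (fun i _ j _ hij => hind.indepFun hij)]
      exact hvar.sum_le_tsum _ fun j _ => variance_nonneg _ _
    rw [(hfL N).eLpNorm_eq_integral_rpow_norm (by simp) (by simp)]
    refine ENNReal.ofReal_le_ofReal ?_
    rw [Real.sqrt_eq_rpow]
    simp only [ENNReal.toReal_ofNat, Real.rpow_ofNat, Real.norm_eq_abs, sq_abs]
    rw [one_div]
    exact Real.rpow_le_rpow (integral_nonneg fun _ => sq_nonneg _) h2 (by norm_num)
  filter_upwards [hmart.submartingale.exists_ae_tendsto_of_bdd hbdd] with ω ⟨l, hl⟩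
  refine ⟨l, (tendsto_add_atTop_iff_nat 1).1 ?_⟩
  simpa [hf] using hl

/-! ### Independent random signs -/

/-- The law of the sign sequence `ξ`: independent uniform signs. -/
noncomputable abbrev signLaw : Measure (ℕ → ℤˣ) :=
  Measure.infinitePi fun _ : ℕ => uniformOn (Set.univ : Set ℤˣ)

/-- The law of the bucket sequence `h`: independent uniform elements of `Fin m`. -/
noncomputable abbrev bucketLaw (m : ℕ) [NeZero m] : Measure (ℕ → Fin m) :=
  Measure.infinitePi fun _ : ℕ => uniformOn (Set.univ : Set (Fin m))

theorem real_uniformOn_univ_singleton {α : Type*} [Fintype α] [MeasurableSpace α]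
    [MeasurableSingletonClass α] (a : α) :
    (uniformOn (Set.univ : Set α)).real {a} = (Fintype.card α : ℝ)⁻¹ := by
  rw [measureReal_def, uniformOn_univ]
  simp

theorem measurePreserving_mul_left_uniformOn (u : ℤˣ) :
    MeasurePreserving (u * ·) (uniformOn (Set.univ : Set ℤˣ)) (uniformOn Set.univ) := by
  refine ⟨Measurable.of_discrete, Measure.ext_of_singleton fun v => ?_⟩
  rw [Measure.map_apply Measurable.of_discrete (measurableSet_singleton v)]
  have : (u * ·) ⁻¹' {v} = {u⁻¹ * v} := by
    ext w; simp
  rw [this, uniformOn_univ, uniformOn_univ]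
  simp

/-- The law of the signs is invariant under flipping any fixed set of coordinates. -/
theorem measurePreserving_mul_left_signLaw (u : ℕ → ℤˣ) :
    MeasurePreserving (u * ·) signLaw signLaw := by
  refine ⟨by fun_prop, ?_⟩
  have h := Measure.infinitePi_map_pi (μ := fun _ : ℕ => uniformOn (Set.univ : Set ℤˣ))
    (f := fun j => (u j * ·)) fun j => Measurable.of_discrete
  simp only [(measurePreserving_mul_left_uniformOn _).map_eq] at h
  exact h

theorem measurable_sign (j : ℕ) : Measurable fun ξ : ℕ → ℤˣ => ((ξ j : ℤ) : ℝ) :=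
  (Measurable.of_discrete (f := fun u : ℤˣ => ((u : ℤ) : ℝ))).comp (measurable_pi_apply j)

theorem sign_sq (u : ℤˣ) : ((u : ℤ) : ℝ) ^ 2 = 1 := by
  rcases Int.units_eq_one_or u with rfl | rfl <;> simp

theorem integral_sign (j : ℕ) : ∫ ξ, ((ξ j : ℤ) : ℝ) ∂signLaw = 0 := by
  have h := (measurePreserving_mul_left_signLaw fun _ => -1).hasLaw.integral_comp
    (f := fun ξ => ((ξ j : ℤ) : ℝ)) (measurable_sign j).aestronglyMeasurable
  simp only [Function.comp_def, Pi.mul_apply, neg_one_mul, Units.val_neg, Int.cast_neg,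
    integral_neg] at h
  linarith

theorem iIndepFun_sign : iIndepFun (fun j (ξ : ℕ → ℤˣ) => ((ξ j : ℤ) : ℝ)) signLaw :=
  iIndepFun_infinitePi (X := fun _ (u : ℤˣ) => ((u : ℤ) : ℝ)) fun _ => Measurable.of_discrete

theorem ae_exists_tendsto_sum_sign {y : ℕ → ℝ} (hy : Summable fun j => y j ^ 2) :
    ∀ᵐ ξ ∂signLaw, ∃ l,
      Tendsto (fun N => ∑ j ∈ Finset.range N, ((ξ j : ℤ) : ℝ) * y j) atTop (𝓝 l) := by
  have hmeas : ∀ j, Measurable fun ξ : ℕ → ℤˣ => ((ξ j : ℤ) : ℝ) * y j :=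
    fun j => (measurable_sign j).mul_const _
  have hL : ∀ j, MemLp (fun ξ : ℕ → ℤˣ => ((ξ j : ℤ) : ℝ) * y j) 2 signLaw := fun j =>
    MemLp.of_bound (hmeas j).aestronglyMeasurable |y j| <| .of_forall fun ξ => by
      rcases Int.units_eq_one_or (ξ j) with h | h <;> simp [h]
  have hmean : ∀ j, ∫ ξ, ((ξ j : ℤ) : ℝ) * y j ∂signLaw = 0 := fun j => by
    rw [integral_mul_const, integral_sign, zero_mul]
  refine ae_exists_tendsto_sum_of_iIndepFun (fun j => (hmeas j).stronglyMeasurable) hL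
    (iIndepFun_sign.comp (fun j t => t * y j) fun j => by fun_prop) hmean ?_
  refine hy.congr fun j => ?_
  rw [variance_of_integral_eq_zero (hmeas j).aemeasurable (hmean j)]
  simp [mul_pow, sign_sq]

/-! ### Exponential moments of the hashed norm for fixed buckets -/

/-- The squared norm `∑_{j < N, h j = i} x_j²` of the part of `x` that is hashed to bucket `i`. -/
noncomputable def bucketMass {m : ℕ} (h : ℕ → Fin m) (x : ℕ → ℝ) (i : Fin m) (N : ℕ) : ℝ :=
  ∑ j ∈ Finset.range N with h j = i, x j ^ 2

theorem bucketMass_nonneg {m : ℕ} (h : ℕ → Fin m) (x : ℕ → ℝ) (i : Fin m) (N : ℕ) :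
    0 ≤ bucketMass h x i N :=
  Finset.sum_nonneg fun _ _ => sq_nonneg _

theorem bucketMass_succ {m : ℕ} (h : ℕ → Fin m) (x : ℕ → ℝ) (i : Fin m) (N : ℕ) :
    bucketMass h x i (N + 1) = bucketMass h x i N + if h N = i then x N ^ 2 else 0 := by
  simp only [bucketMass, Finset.sum_filter, Finset.sum_range_succ]

theorem sum_bucketMass {m : ℕ} (h : ℕ → Fin m) (x : ℕ → ℝ) (N : ℕ) :
    ∑ i, bucketMass h x i N = ∑ j ∈ Finset.range N, x j ^ 2 := by
  simp only [bucketMass, Finset.sum_fiberwise]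

theorem hashPartialSum_succ {m : ℕ} (h : ℕ → Fin m) (ξ : ℕ → ℤˣ) (x : lp (fun _ : ℕ => ℝ) 2)
    (i : Fin m) (N : ℕ) :
    hashPartialSum h ξ x i (N + 1) =
      hashPartialSum h ξ x i N + if h N = i then ((ξ N : ℤ) : ℝ) * x N else 0 := by
  simp only [hashPartialSum, Finset.sum_filter, Finset.sum_range_succ]

theorem measurable_hashPartialSum {m : ℕ} (h : ℕ → Fin m) (x : lp (fun _ : ℕ => ℝ) 2) (i : Fin m)
    (N : ℕ) : Measurable fun ξ => hashPartialSum h ξ x i N :=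
  Finset.measurable_sum _ fun j _ => (measurable_sign j).mul_const _

theorem measurable_hashPartialSum_prod {m : ℕ} (x : lp (fun _ : ℕ => ℝ) 2) (i : Fin m)
    (N : ℕ) :
    Measurable fun p : (ℕ → Fin m) × (ℕ → ℤˣ) => hashPartialSum p.1 p.2 x i N := by
  simp only [hashPartialSum, Finset.sum_filter]
  refine Finset.measurable_sum _ fun j _ => Measurable.ite ?_ ?_ measurable_const
  · exact measurableSet_eq_fun ((measurable_pi_apply j).comp measurable_fst) measurable_const
  · exact ((measurable_sign j).comp measurable_snd).mul_const _

/-- Averaging `F` with its translate by a sign pattern `u` does not change its expectation, so a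
pointwise bound on the average is enough. -/
theorem lintegral_signLaw_le_of_flip {F G : (ℕ → ℤˣ) → ℝ} (hF : Measurable F) (hF0 : ∀ ξ, 0 ≤ F ξ)
    (u : ℕ → ℤˣ) (hFG : ∀ ξ, F ξ + F (u * ξ) ≤ 2 * G ξ) :
    ∫⁻ ξ, ENNReal.ofReal (F ξ) ∂signLaw ≤ ∫⁻ ξ, ENNReal.ofReal (G ξ) ∂signLaw := by
  have hflip : ∫⁻ ξ, ENNReal.ofReal (F (u * ξ)) ∂signLaw = ∫⁻ ξ, ENNReal.ofReal (F ξ) ∂signLaw :=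
    (measurePreserving_mul_left_signLaw u).lintegral_comp (f := fun ξ => ENNReal.ofReal (F ξ))
      hF.ennreal_ofReal
  have h2 : 2 * ∫⁻ ξ, ENNReal.ofReal (F ξ) ∂signLaw ≤
      2 * ∫⁻ ξ, ENNReal.ofReal (G ξ) ∂signLaw := by
    calc 2 * ∫⁻ ξ, ENNReal.ofReal (F ξ) ∂signLaw
        = ∫⁻ ξ, ENNReal.ofReal (F ξ) + ENNReal.ofReal (F (u * ξ)) ∂signLaw := by
          rw [lintegral_add_left hF.ennreal_ofReal, hflip, two_mul]
      _ ≤ ∫⁻ ξ, 2 * ENNReal.ofReal (G ξ) ∂signLaw := by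
          refine lintegral_mono fun ξ => ?_
          rw [← ENNReal.ofReal_add (hF0 _) (hF0 _)]
          refine (ENNReal.ofReal_le_ofReal (hFG ξ)).trans ?_
          rw [ENNReal.ofReal_mul (by norm_num), ENNReal.ofReal_ofNat]
      _ = 2 * ∫⁻ ξ, ENNReal.ofReal (G ξ) ∂signLaw := lintegral_const_mul' _ _ (by simp)
  exact (ENNReal.mul_le_mul_iff_right (by simp) (by simp)).1 h2

/-- The bookkeeping for one more coordinate of square `y` in a bucket of mass `S`: averaging over its
sign replaces the coefficient `a` of the bucket by `a + 2 a² y` and costs a factor `exp (a y)`. The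
smallness condition is preserved, and the exponent `a S + 2 a² S²` grows at least by the cost. -/
theorem exponent_step {a S y : ℝ} (hS : 0 ≤ S) (hy : 0 ≤ y) (ha : |a| * (S + y) ≤ 1 / 8) :
    |a + 2 * a ^ 2 * y| * S ≤ 1 / 8 ∧
      a * y + ((a + 2 * a ^ 2 * y) * S + 2 * (a + 2 * a ^ 2 * y) ^ 2 * S ^ 2) ≤
        a * (S + y) + 2 * a ^ 2 * (S + y) ^ 2 := by
  have haS : |a| * S ≤ 1 / 8 := le_trans (by gcongr; linarith) ha
  have h1 : |a + 2 * a ^ 2 * y| ≤ |a| + 2 * |a| ^ 2 * y := by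
    refine (abs_add_le _ _).trans (le_of_eq ?_)
    rw [abs_mul, abs_mul, abs_pow, abs_of_nonneg hy]; norm_num
  have hby : 0 ≤ |a| * y := by positivity
  have hbS : 0 ≤ |a| * S := by positivity
  constructor
  · calc |a + 2 * a ^ 2 * y| * S ≤ (|a| + 2 * |a| ^ 2 * y) * S := by gcongr
      _ = |a| * S + 2 * (|a| * y) * (|a| * S) := by ring
      _ ≤ |a| * S + 2 * (|a| * y) * (1 / 8) := by gcongr
      _ ≤ 1 / 8 := by linarith
  · have h3 : (a + 2 * a ^ 2 * y) ^ 2 * S ^ 2 ≤ a ^ 2 * S ^ 2 + a ^ 2 * y * S * (1 / 2 + 1 / 8) := by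
      have e : (a + 2 * a ^ 2 * y) ^ 2 * S ^ 2 =
          a ^ 2 * S ^ 2 + a ^ 2 * y * S * (4 * (a * S) + 4 * (a * y) * (a * S)) := by ring
      rw [e]
      have h4 : a * S ≤ 1 / 8 := (mul_le_mul_of_nonneg_right (le_abs_self a) hS).trans haS
      have h5 : (a * y) * (a * S) ≤ 1 / 8 * (1 / 8) := by
        calc (a * y) * (a * S) ≤ |(a * y) * (a * S)| := le_abs_self _
          _ = (|a| * y) * (|a| * S) := by
            rw [abs_mul, abs_mul, abs_mul, abs_of_nonneg hy, abs_of_nonneg hS]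
          _ ≤ 1 / 8 * (1 / 8) := by
            gcongr
            linarith
      gcongr
      · linarith
      · linarith
    have : 0 ≤ a ^ 2 * y * S := by positivity
    have : 0 ≤ a ^ 2 * y ^ 2 := by positivity
    nlinarith

/-- For fixed buckets, with masses `S_i` and small coefficients of either sign,
`E exp (∑ a_i φ_i²) ≤ exp (∑ (a_i S_i + 2 a_i² S_i²))`. The proof averages over the sign of the last
coordinate `x_N`: in its bucket, `E exp (a (φ ± x_N)²) = exp (a φ² + a x_N²) cosh (2 a φ x_N)`, and
`cosh t ≤ exp (t² / 2)` turns this into the same expression with the coefficient `a + 2 a² x_N²`. -/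
theorem lintegral_exp_sum_sq_le {m : ℕ} (h : ℕ → Fin m) (x : lp (fun _ : ℕ => ℝ) 2) (N : ℕ)
    (a : Fin m → ℝ) (ha : ∀ i, |a i| * bucketMass h x i N ≤ 1 / 8) :
    ∫⁻ ξ, ENNReal.ofReal (Real.exp (∑ i, a i * hashPartialSum h ξ x i N ^ 2)) ∂signLaw ≤
      ENNReal.ofReal (Real.exp
        (∑ i, (a i * bucketMass h x i N + 2 * a i ^ 2 * bucketMass h x i N ^ 2))) := by
  induction N generalizing a with
  | zero => simp [hashPartialSum, bucketMass]
  | succ N ih =>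
    -- Only the bucket `k` of the new coordinate changes.
    set k := h N with hk
    set S := fun i => bucketMass h x i N with hS
    have hSk : bucketMass h x k (N + 1) = S k + x N ^ 2 := by simp [bucketMass_succ, hS, hk]
    have hSi : ∀ i, i ≠ k → bucketMass h x i (N + 1) = S i := fun i hi => by
      simp [bucketMass_succ, hS, hk ▸ hi.symm]
    set b := Function.update a k (a k + 2 * a k ^ 2 * x N ^ 2) with hb
    obtain ⟨hstep1, hstep2⟩ := exponent_step (a := a k) (bucketMass_nonneg h x k N)
      (sq_nonneg (x N)) (hSk ▸ ha k)
    have hbS : ∀ i, |b i| * S i ≤ 1 / 8 := by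
      intro i
      rcases eq_or_ne i k with rfl | hi
      · simpa [hb] using hstep1
      · simpa [hb, hi, hSi i hi] using ha i
    have hsum : ∀ f g : Fin m → ℝ, (∀ i, i ≠ k → f i = g i) →
        ∑ i, f i = ∑ i, g i + (f k - g k) := by
      intro f g hfg
      rw [← sub_eq_iff_eq_add', ← Finset.sum_sub_distrib]
      exact Finset.sum_eq_single k (fun i _ hi => by simp [hfg i hi]) (by simp)
    have hexp : ∀ ξ : ℕ → ℤˣ, ∑ i, a i * hashPartialSum h ξ x i (N + 1) ^ 2 =
        (∑ i, a i * hashPartialSum h ξ x i N ^ 2 + a k * x N ^ 2) +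
          2 * a k * hashPartialSum h ξ x k N * x N * ((ξ N : ℤ) : ℝ) := by
      intro ξ
      rw [hsum _ (fun i => a i * hashPartialSum h ξ x i N ^ 2)]
      · rw [hashPartialSum_succ, if_pos hk.symm]
        linear_combination a k * x N ^ 2 * sign_sq (ξ N)
      · intro i hi
        rw [hashPartialSum_succ, if_neg (fun e => hi (e.symm.trans hk.symm)), add_zero]
    -- Multiplication by `u` flips the sign of coordinate `N` and leaves the earlier sums alone.
    set u : ℕ → ℤˣ := Pi.mulSingle N (-1) with hu
    have hflip : ∀ ξ i, hashPartialSum h (u * ξ) x i N = hashPartialSum h ξ x i N := by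
      intro ξ i
      refine Finset.sum_congr rfl fun j hj => ?_
      have hj' : j ≠ N := by
        have := Finset.mem_range.1 (Finset.mem_filter.1 hj).1
        omega
      simp [hu, Pi.mulSingle_eq_of_ne hj']
    have hflipN : ∀ ξ : ℕ → ℤˣ, (((u * ξ) N : ℤ) : ℝ) = -((ξ N : ℤ) : ℝ) := by
      intro ξ; simp [hu]
    have hmeas : Measurable fun ξ =>
        Real.exp (∑ i, a i * hashPartialSum h ξ x i (N + 1) ^ 2) :=
      (Finset.measurable_sum _ fun i _ =>
        ((measurable_hashPartialSum h x i (N + 1)).pow_const 2).const_mul (a i)).exp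
    have hG := lintegral_signLaw_le_of_flip hmeas (fun _ => (Real.exp_pos _).le) u
      (G := fun ξ => Real.exp (a k * x N ^ 2) *
        Real.exp (∑ i, b i * hashPartialSum h ξ x i N ^ 2)) ?_
    · refine hG.trans ?_
      simp only [ENNReal.ofReal_mul (Real.exp_pos (a k * x N ^ 2)).le]
      rw [lintegral_const_mul' _ _ (by simp)]
      refine (mul_le_mul_right (ih b hbS) _).trans ?_
      rw [← ENNReal.ofReal_mul (Real.exp_pos _).le, ← Real.exp_add]
      refine ENNReal.ofReal_le_ofReal (Real.exp_le_exp.2 ?_)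
      rw [hsum
        (fun i => a i * bucketMass h x i (N + 1) + 2 * a i ^ 2 * bucketMass h x i (N + 1) ^ 2)
        (fun i => b i * bucketMass h x i N + 2 * b i ^ 2 * bucketMass h x i N ^ 2)]
      · have hbk : b k = a k + 2 * a k ^ 2 * x N ^ 2 := by simp [hb]
        simp only [hSk, hbk, hS]
        linarith
      · intro i hi
        simp [hSi i hi, hb, hi, hS]
    · intro ξ
      rw [hexp, hexp, hflipN]
      simp only [hflip]
      set A := ∑ i, a i * hashPartialSum h ξ x i N ^ 2 + a k * x N ^ 2 with hA
      set t := 2 * a k * hashPartialSum h ξ x k N * x N with ht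
      have hb' : a k * x N ^ 2 + ∑ i, b i * hashPartialSum h ξ x i N ^ 2 = A + t ^ 2 / 2 := by
        rw [hsum (fun i => b i * hashPartialSum h ξ x i N ^ 2)
          (fun i => a i * hashPartialSum h ξ x i N ^ 2)]
        · simp only [hb, Function.update_self, hA, ht]
          ring
        · intro i hi
          simp [hb, hi]
      clear_value A t
      have hc : Real.exp (A + t * ((ξ N : ℤ) : ℝ)) + Real.exp (A + t * -((ξ N : ℤ) : ℝ)) =
          2 * (Real.exp A * Real.cosh t) := by
        rw [Real.cosh_eq, Real.exp_add, Real.exp_add]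
        rcases Int.units_eq_one_or (ξ N) with h | h <;> simp [h] <;> ring
      rw [hc, ← Real.exp_add, hb', Real.exp_add]
      gcongr
      exact Real.cosh_le_exp_half_sq t

/-- Two-sided tail of the squared norm of the hashed vector when no bucket has mass above `s`: Markov's
inequality for `exp (± l Z)`, using `∑ S_i² ≤ s ∑ S_i`. -/
theorem signLaw_tail_le {m : ℕ} (h : ℕ → Fin m) (x : lp (fun _ : ℕ => ℝ) 2) (N : ℕ)
    {l s t : ℝ} (hl : 0 ≤ l) (hs : ∀ i, bucketMass h x i N ≤ s) (hls : l * s ≤ 1 / 8) :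
    signLaw {ξ | t < |∑ i, hashPartialSum h ξ x i N ^ 2 - ∑ j ∈ Finset.range N, x j ^ 2|} ≤
      ENNReal.ofReal (2 * Real.exp (-(l * t) + 2 * l ^ 2 * s * ∑ j ∈ Finset.range N, x j ^ 2)) := by
  set n := ∑ j ∈ Finset.range N, x j ^ 2 with hn
  set E := Real.exp (-(l * t) + 2 * l ^ 2 * s * n) with hE
  have key : ∀ a : ℝ, |a| = l →
      signLaw {ξ | l * t ≤ a * (∑ i, hashPartialSum h ξ x i N ^ 2 - n)} ≤ ENNReal.ofReal E := by
    intro a ha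
    have h1 := lintegral_exp_sum_sq_le h x N (fun _ => a) fun i => by
      rw [ha]; exact (mul_le_mul_of_nonneg_left (hs i) hl).trans hls
    have hmeas : Measurable fun ξ => Real.exp (∑ i, a * hashPartialSum h ξ x i N ^ 2) :=
      (Finset.measurable_sum _ fun i _ =>
        ((measurable_hashPartialSum h x i N).pow_const 2).const_mul a).exp
    have h2 := meas_ge_le_lintegral_div (μ := signLaw) hmeas.ennreal_ofReal.aemeasurable
      (ε := ENNReal.ofReal (Real.exp (l * t + a * n)))
      (by simp [Real.exp_pos]) (by simp)
    calc signLaw {ξ | l * t ≤ a * (∑ i, hashPartialSum h ξ x i N ^ 2 - n)}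
        ≤ _ := measure_mono fun ξ hξ => ?_
      _ ≤ _ := h2
      _ ≤ _ := ENNReal.div_le_of_le_mul ?_
    · simp only [Set.mem_ofPred_eq] at hξ ⊢
      refine ENNReal.ofReal_le_ofReal (Real.exp_le_exp.2 ?_)
      rw [← Finset.mul_sum]
      linarith
    · refine h1.trans ?_
      rw [← ENNReal.ofReal_mul (Real.exp_pos _).le, ← Real.exp_add]
      refine ENNReal.ofReal_le_ofReal (Real.exp_le_exp.2 ?_)
      have h3 : ∑ i, bucketMass h x i N ^ 2 ≤ s * n := by
        rw [hn, ← sum_bucketMass h x N, Finset.mul_sum]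
        refine Finset.sum_le_sum fun i _ => ?_
        rw [sq]
        exact mul_le_mul_of_nonneg_right (hs i) (bucketMass_nonneg h x i N)
      have h4 : ∑ i, (a * bucketMass h x i N + 2 * a ^ 2 * bucketMass h x i N ^ 2) =
          a * n + 2 * l ^ 2 * ∑ i, bucketMass h x i N ^ 2 := by
        rw [Finset.sum_add_distrib, ← Finset.mul_sum, ← Finset.mul_sum, sum_bucketMass, ← ha, sq_abs]
      rw [h4]
      nlinarith [mul_le_mul_of_nonneg_left h3 (sq_nonneg l)]
  have hsub : {ξ | t < |∑ i, hashPartialSum h ξ x i N ^ 2 - n|} ⊆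
      {ξ | l * t ≤ l * (∑ i, hashPartialSum h ξ x i N ^ 2 - n)} ∪
        {ξ | l * t ≤ -l * (∑ i, hashPartialSum h ξ x i N ^ 2 - n)} := by
    intro ξ hξ
    simp only [Set.mem_union, Set.mem_ofPred_eq] at hξ ⊢
    rcases lt_abs.1 hξ with h | h
    · exact .inl (mul_le_mul_of_nonneg_left h.le hl)
    · right
      simp only [neg_mul, ← mul_neg]
      exact mul_le_mul_of_nonneg_left h.le hl
  refine (measure_mono hsub).trans ((measure_union_le _ _).trans ?_)
  rw [two_mul, ENNReal.ofReal_add (Real.exp_pos _).le (Real.exp_pos _).le]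
  exact add_le_add (key l (abs_of_nonneg hl)) (key (-l) (by rw [abs_neg, abs_of_nonneg hl]))

/-! ### Almost sure convergence of the hashed feature map -/

theorem hasSum_sq_norm_sq (x : lp (fun _ : ℕ => ℝ) 2) : HasSum (fun j => x j ^ 2) (‖x‖ ^ 2) := by
  simpa using lp.hasSum_norm (p := 2) (by simp) x

theorem ae_tendsto_hashPartialSum (m : ℕ) [NeZero m] (x : lp (fun _ : ℕ => ℝ) 2) :
    ∀ᵐ p ∂(hashLaw m), ∀ i : Fin m,
      Tendsto (hashPartialSum p.1 p.2 x i) atTop (𝓝 (hashMap p.1 p.2 x i)) := by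
  refine ae_all_iff.2 fun i => ?_
  have hex : ∀ᵐ p ∂(hashLaw m),
      ∃ l, Tendsto (fun N => hashPartialSum p.1 p.2 x i N) atTop (𝓝 l) := by
    refine (Measure.ae_prod_iff_ae_ae
      (measurableSet_exists_tendsto fun N => measurable_hashPartialSum_prod x i N)).2 (.of_forall ?_)
    intro h
    have hy : Summable fun j => (if h j = i then x j else 0) ^ 2 := by
      refine (hasSum_sq_norm_sq x).summable.of_nonneg_of_le (fun _ => sq_nonneg _) fun j => ?_
      split_ifs
      · exact le_rfl
      · simpa using sq_nonneg (x j)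
    filter_upwards [ae_exists_tendsto_sum_sign hy] with ξ hξ
    simpa only [hashPartialSum, Finset.sum_filter, mul_ite, mul_zero] using hξ
  filter_upwards [hex] with p hp
  exact tendsto_nhds_limUnder hp

/-! ### Bucket masses -/

theorem mgf_indicator_bucket_le {m : ℕ} [NeZero m] (j : ℕ) (i : Fin m) {u : ℝ}
    (hu0 : 0 ≤ u) (hu1 : u ≤ 1) :
    mgf (fun h : ℕ → Fin m => if h j = i then u else 0) (bucketLaw m) 1 ≤
      Real.exp (2 * u / m) := by
  have hm : (0 : ℝ) < m := Nat.cast_pos.2 (NeZero.pos m)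
  have h1 : mgf (fun h : ℕ → Fin m => if h j = i then u else 0) (bucketLaw m) 1 =
      ∫ k, Real.exp (if k = i then u else 0) ∂(uniformOn (Set.univ : Set (Fin m))) := by
    rw [mgf]
    simp only [one_mul]
    exact (measurePreserving_eval_infinitePi
      (fun _ : ℕ => uniformOn (Set.univ : Set (Fin m))) j).hasLaw.integral_comp
        (f := fun k => Real.exp (if k = i then u else 0))
        Measurable.of_discrete.aestronglyMeasurable
  have h2 : ∀ k : Fin m, Real.exp (if k = i then u else 0) =
      1 + if k = i then Real.exp u - 1 else 0 := by
    intro k; split_ifs <;> simp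
  have h3 : Real.exp u - 1 ≤ 2 * u := by
    have := Real.abs_exp_sub_one_sub_id_le (x := u) (by rwa [abs_of_nonneg hu0])
    nlinarith [(abs_le.1 this).2]
  rw [h1, integral_fintype .of_finite]
  simp only [real_uniformOn_univ_singleton, smul_eq_mul, ← Finset.mul_sum, h2,
    Finset.sum_add_distrib, Finset.sum_ite_eq', Finset.mem_univ, if_true, Fintype.card_fin,
    Finset.sum_const, Finset.card_univ, nsmul_eq_mul, mul_one]
  calc (m : ℝ)⁻¹ * (m + (Real.exp u - 1)) ≤ (m : ℝ)⁻¹ * (m + 2 * u) := by gcongr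
    _ = 2 * u / m + 1 := by field_simp; ring
    _ ≤ Real.exp (2 * u / m) := Real.add_one_le_exp _

/-- Chernoff bound for the mass of one bucket, a sum of independent variables in `[0, M]` with total
mean at most `n / m`. -/
theorem bucketLaw_mass_tail_le {m : ℕ} [NeZero m] (x : ℕ → ℝ) (i : Fin m) (N : ℕ) {M s n : ℝ}
    (hM : 0 < M) (hx : ∀ j, x j ^ 2 ≤ M) (hn : ∑ j ∈ Finset.range N, x j ^ 2 ≤ n) :
    bucketLaw m {h | s < bucketMass h x i N} ≤
      ENNReal.ofReal (Real.exp (-(s / M) + 2 * n / (m * M))) := by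
  have hm : (0 : ℝ) < m := Nat.cast_pos.2 (NeZero.pos m)
  set X : ℕ → (ℕ → Fin m) → ℝ := fun j h => if h j = i then x j ^ 2 / M else 0 with hX
  have hXm : ∀ j, Measurable (X j) := fun j =>
    (Measurable.of_discrete (f := fun k : Fin m => if k = i then x j ^ 2 / M else 0)).comp
      (measurable_pi_apply j)
  have hind : iIndepFun X (bucketLaw m) :=
    iIndepFun_infinitePi (X := fun j (k : Fin m) => if k = i then x j ^ 2 / M else 0)
      fun _ => Measurable.of_discrete
  have hsum : ∀ h, (∑ j ∈ Finset.range N, X j) h = bucketMass h x i N / M := by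
    intro h
    simp only [Finset.sum_apply, hX, bucketMass, Finset.sum_filter, Finset.sum_div]
    exact Finset.sum_congr rfl fun j _ => by split_ifs <;> simp
  have hX1 : ∀ j h, X j h ≤ 1 := fun j h => by
    simp only [hX]
    split_ifs
    · exact (div_le_one hM).2 (hx j)
    · exact zero_le_one
  have hint : Integrable (fun h => Real.exp (1 * (∑ j ∈ Finset.range N, X j) h)) (bucketLaw m) := by
    refine Integrable.of_bound (C := Real.exp N) ?_ (.of_forall fun h => ?_)
    · simp only [Finset.sum_apply]
      exact ((Finset.measurable_sum _ fun j _ => hXm j).const_mul 1).exp.aestronglyMeasurable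
    · rw [Real.norm_eq_abs, Real.abs_exp, one_mul, Finset.sum_apply, Real.exp_le_exp]
      simpa using Finset.sum_le_card_nsmul (Finset.range N) (fun j => X j h) 1 fun j _ => hX1 j h
  have hmgf : mgf (∑ j ∈ Finset.range N, X j) (bucketLaw m) 1 ≤ Real.exp (2 * n / (m * M)) := by
    rw [hind.mgf_sum hXm]
    calc ∏ j ∈ Finset.range N, mgf (X j) (bucketLaw m) 1
        ≤ ∏ j ∈ Finset.range N, Real.exp (2 * (x j ^ 2 / M) / m) :=
          Finset.prod_le_prod (fun j _ => mgf_nonneg) fun j _ =>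
            mgf_indicator_bucket_le j i (by positivity) ((div_le_one hM).2 (hx j))
      _ = Real.exp (2 * (∑ j ∈ Finset.range N, x j ^ 2) / (m * M)) := by
          rw [← Real.exp_sum, ← Finset.sum_div, ← Finset.mul_sum, ← Finset.sum_div]
          congr 1; field_simp
      _ ≤ _ := by gcongr
  have hch := measure_ge_le_exp_mul_mgf (s / M) zero_le_one hint
  calc bucketLaw m {h | s < bucketMass h x i N}
      ≤ bucketLaw m {h | s / M ≤ (∑ j ∈ Finset.range N, X j) h} := measure_mono fun h hh => by
        simp only [Set.mem_ofPred_eq, hsum] at hh ⊢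
        gcongr
    _ ≤ _ := by
        rw [← ofReal_measureReal]
        refine ENNReal.ofReal_le_ofReal (hch.trans ?_)
        rw [Real.exp_add, neg_one_mul]
        gcongr

/-! ### Norms -/

/-- Concentration of the squared norm of the truncated hashed vector. The buckets all have mass at most
`s = ε² ‖x‖² / (16 log (12 / δ))` outside an event of probability `δ / 12`; given such buckets, the
tail over the signs has probability at most `δ / 6`. -/
theorem hashLaw_partial_tail_le {m : ℕ} [NeZero m] (x : lp (fun _ : ℕ => ℝ) 2) (N : ℕ)
    {ε δ : ℝ} (hε : 0 < ε) (hε1 : ε < 1) (hδ : 0 < δ) (hδ1 : δ < 1)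
    (hm : 64 * Real.log (12 / δ) / ε ^ 2 ≤ m)
    (hx : ∀ j, |x j| ≤ ε / (6 * Real.log (12 * m / δ)) * ‖x‖) :
    hashLaw m {p | ε * ‖x‖ ^ 2 <
      |∑ i, hashPartialSum p.1 p.2 x i N ^ 2 - ∑ j ∈ Finset.range N, x j ^ 2|} ≤
        ENNReal.ofReal (δ / 4) := by
  rcases eq_or_ne x 0 with rfl | hx0
  · simp [hashPartialSum]
  have hm1 : (1 : ℝ) ≤ m := Nat.one_le_cast.2 (NeZero.pos m)
  have hm0 : (0 : ℝ) < m := by linarith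
  set L := Real.log (12 / δ) with hL
  set Λ := Real.log (12 * m / δ) with hΛ
  set n := ‖x‖ ^ 2 with hn
  have hn0 : 0 < n := by have := norm_pos_iff.2 hx0; positivity
  have hL0 : 0 < L := Real.log_pos (by rw [lt_div_iff₀ hδ]; linarith)
  have hLΛ : L ≤ Λ := Real.log_le_log (by positivity) (by gcongr; linarith)
  have hΛ0 : 0 < Λ := hL0.trans_le hLΛ
  have hNn : ∑ j ∈ Finset.range N, x j ^ 2 ≤ n :=
    sum_le_hasSum _ (fun _ _ => sq_nonneg _) (hasSum_sq_norm_sq x)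
  set s := ε ^ 2 * n / (16 * L) with hs
  -- `l` makes the Chernoff exponent `- l ε n + 2 l² s n` at most `- 2 L + L / 2`.
  set l := 2 * L / (ε * n) with hl
  -- `M` bounds the squares of the coordinates.
  set M := ε ^ 2 * n / (36 * Λ ^ 2) with hM
  have hM0 : 0 < M := by positivity
  have hxM : ∀ j, x j ^ 2 ≤ M := by
    intro j
    rw [← sq_abs]
    calc |x j| ^ 2 ≤ (ε / (6 * Λ) * ‖x‖) ^ 2 := by gcongr; exact hx j
      _ = M := by rw [hM, hn]; field_simp; norm_num
  have hbucket : ∀ i : Fin m, bucketLaw m {h | s < bucketMass h x i N} ≤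
      ENNReal.ofReal (δ / (12 * m)) := by
    intro i
    refine (bucketLaw_mass_tail_le x i N hM0 hxM hNn).trans (ENNReal.ofReal_le_ofReal ?_)
    have h1 : 2 * n / (m * M) ≤ 9 / 8 * (Λ ^ 2 / L) := by
      have h64 : 64 * L ≤ m * ε ^ 2 := (div_le_iff₀ (by positivity)).1 hm
      have : 2 * n / (m * M) = 72 * Λ ^ 2 / (m * ε ^ 2) := by
        rw [hM]; field_simp; norm_num
      rw [this]
      calc 72 * Λ ^ 2 / (m * ε ^ 2) ≤ 72 * Λ ^ 2 / (64 * L) := by gcongr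
        _ = 9 / 8 * (Λ ^ 2 / L) := by field_simp; norm_num
    have h2 : s / M = 9 / 4 * (Λ ^ 2 / L) := by
      rw [hs, hM]; field_simp; norm_num
    have h3 : Λ ≤ Λ ^ 2 / L := by
      rw [le_div_iff₀ hL0, sq]; gcongr
    calc Real.exp (-(s / M) + 2 * n / (m * M)) ≤ Real.exp (-Λ) :=
          Real.exp_le_exp.2 (by rw [h2]; linarith)
      _ = δ / (12 * m) := by
          rw [Real.exp_neg, hΛ, Real.exp_log (by positivity), inv_div]
  set bad : Set (ℕ → Fin m) := ⋃ i, {h | s < bucketMass h x i N} with hbad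
  have hbadm : MeasurableSet bad := by
    refine MeasurableSet.iUnion fun i => measurableSet_lt measurable_const ?_
    simp only [bucketMass, Finset.sum_filter]
    exact Finset.measurable_sum _ fun j _ =>
      (Measurable.of_discrete (f := fun k : Fin m => if k = i then x j ^ 2 else 0)).comp
        (measurable_pi_apply j)
  have hbadle : bucketLaw m bad ≤ ENNReal.ofReal (δ / 12) := by
    refine (measure_iUnion_fintype_le _ _).trans ((Finset.sum_le_sum fun i _ => hbucket i).trans ?_)
    rw [Finset.sum_const, Finset.card_univ, Fintype.card_fin, nsmul_eq_mul,
      ← ENNReal.ofReal_natCast, ← ENNReal.ofReal_mul (by positivity)]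
    refine ENNReal.ofReal_le_ofReal (le_of_eq ?_)
    field_simp
  set B := {p : (ℕ → Fin m) × (ℕ → ℤˣ) | ε * n <
      |∑ i, hashPartialSum p.1 p.2 x i N ^ 2 - ∑ j ∈ Finset.range N, x j ^ 2|} with hB
  have hBm : MeasurableSet B := by
    refine measurableSet_lt measurable_const (Measurable.abs ?_)
    exact (Finset.measurable_sum _ fun i _ =>
      (measurable_hashPartialSum_prod x i N).pow_const 2).sub_const _
  have hfib : ∀ h, signLaw (Prod.mk h ⁻¹' B) ≤
      bad.indicator 1 h + ENNReal.ofReal (δ / 6) := by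
    intro h
    by_cases hh : h ∈ bad
    · rw [Set.indicator_of_mem hh]
      exact prob_le_one.trans le_self_add
    · rw [Set.indicator_of_notMem hh, zero_add]
      have hsi : ∀ i, bucketMass h x i N ≤ s := by
        simpa [hbad] using hh
      refine (signLaw_tail_le h x N (l := l) (t := ε * n) (by positivity) hsi ?_).trans
        (ENNReal.ofReal_le_ofReal ?_)
      · have : l * s = ε / 8 := by rw [hl, hs]; field_simp; norm_num
        linarith
      · have h1 : l * (ε * n) = 2 * L := by rw [hl]; field_simp
        have h2 : 2 * l ^ 2 * s * ∑ j ∈ Finset.range N, x j ^ 2 ≤ L / 2 := by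
          calc 2 * l ^ 2 * s * ∑ j ∈ Finset.range N, x j ^ 2 ≤ 2 * l ^ 2 * s * n := by gcongr
            _ = L / 2 := by rw [hl, hs]; field_simp; norm_num
        calc 2 * Real.exp (-(l * (ε * n)) + 2 * l ^ 2 * s * ∑ j ∈ Finset.range N, x j ^ 2)
            ≤ 2 * Real.exp (-L) := by gcongr; linarith
          _ = δ / 6 := by
            rw [Real.exp_neg, hL, Real.exp_log (by positivity), inv_div]; ring
  calc hashLaw m B = ∫⁻ h, signLaw (Prod.mk h ⁻¹' B) ∂(bucketLaw m) := Measure.prod_apply hBm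
    _ ≤ ∫⁻ h, bad.indicator 1 h + ENNReal.ofReal (δ / 6) ∂(bucketLaw m) := lintegral_mono hfib
    _ = bucketLaw m bad + ENNReal.ofReal (δ / 6) := by
        rw [lintegral_add_right _ measurable_const, lintegral_indicator_one hbadm]
        simp
    _ ≤ ENNReal.ofReal (δ / 12) + ENNReal.ofReal (δ / 6) := by gcongr
    _ = ENNReal.ofReal (δ / 4) := by
        rw [← ENNReal.ofReal_add (by positivity) (by positivity)]; ring_nf

/-- Fatou's lemma for events. -/
theorem measure_le_of_ae_eventually {Ω : Type*} {mΩ : MeasurableSpace Ω} {μ : Measure Ω}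
    {A : Set Ω} {B : ℕ → Set Ω} {c : ENNReal} (hB : ∀ N, μ (B N) ≤ c)
    (hA : ∀ᵐ ω ∂μ, ω ∈ A → ∀ᶠ N in atTop, ω ∈ B N) : μ A ≤ c := by
  have hmono : Monotone fun N => ⋂ K ≥ N, B K := fun N N' hN =>
    Set.biInter_subset_biInter_left fun K (hK : N' ≤ K) => hN.trans hK
  calc μ A ≤ μ (⋃ N, ⋂ K ≥ N, B K) := measure_mono_ae <| by
        filter_upwards [hA] with ω hω hωA
        obtain ⟨N, hN⟩ := eventually_atTop.1 (hω hωA)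
        exact Set.mem_iUnion.2 ⟨N, Set.mem_iInter₂.2 hN⟩
    _ = ⨆ N, μ (⋂ K ≥ N, B K) := hmono.measure_iUnion
    _ ≤ c := iSup_le fun N =>
        (measure_mono (Set.biInter_subset_of_mem (Set.mem_ofPred.2 le_rfl))).trans (hB N)

/-- Concentration of the squared norm of one hashed vector. -/
theorem hashLaw_norm_tail_le {m : ℕ} [NeZero m] (x : lp (fun _ : ℕ => ℝ) 2)
    {ε δ : ℝ} (hε : 0 < ε) (hε1 : ε < 1) (hδ : 0 < δ) (hδ1 : δ < 1)
    (hm : 64 * Real.log (12 / δ) / ε ^ 2 ≤ m)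
    (hx : ∀ j, |x j| ≤ ε / (6 * Real.log (12 * m / δ)) * ‖x‖) :
    hashLaw m {p | ε * ‖x‖ ^ 2 < |‖hashMap p.1 p.2 x‖ ^ 2 - ‖x‖ ^ 2|} ≤
        ENNReal.ofReal (δ / 4) := by
  refine measure_le_of_ae_eventually
    (fun N => hashLaw_partial_tail_le x N hε hε1 hδ hδ1 hm hx) ?_
  filter_upwards [ae_tendsto_hashPartialSum m x] with p hp hlt
  have hlim : Tendsto (fun N => |∑ i, hashPartialSum p.1 p.2 x i N ^ 2 -
      ∑ j ∈ Finset.range N, x j ^ 2|) atTop (𝓝 |‖hashMap p.1 p.2 x‖ ^ 2 - ‖x‖ ^ 2|) := by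
    rw [EuclideanSpace.real_norm_sq_eq]
    exact ((tendsto_finsetSum _ fun i _ => (hp i).pow 2).sub
      (hasSum_sq_norm_sq x).tendsto_sum_nat).abs
  exact hlim.eventually_const_lt hlt

/-! ### Inner products -/

theorem abs_le_of_supRatio_le (x : lp (fun _ : ℕ => ℝ) 2) {η : ℝ} (hη : supRatio x ≤ η) (j : ℕ) :
    |x j| ≤ η * ‖x‖ := by
  have hle : ∀ j, |x j| ≤ ‖x‖ := fun j => lp.norm_apply_le_norm two_ne_zero x j
  rcases eq_or_ne x 0 with rfl | hx0
  · simp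
  · have hj : |x j| ≤ ⨆ j, |x j| := le_ciSup ⟨‖x‖, by rintro _ ⟨j, rfl⟩; exact hle j⟩ j
    exact hj.trans ((div_le_iff₀ (norm_pos_iff.2 hx0)).1 hη)

/-- The hashed feature map is additive where the defining series converge; elsewhere `limUnder` takes
junk values. -/
theorem hashMap_sub {m : ℕ} {h : ℕ → Fin m} {ξ : ℕ → ℤˣ} {x x' : lp (fun _ : ℕ => ℝ) 2}
    (hx : ∀ i, Tendsto (hashPartialSum h ξ x i) atTop (𝓝 (hashMap h ξ x i)))
    (hx' : ∀ i, Tendsto (hashPartialSum h ξ x' i) atTop (𝓝 (hashMap h ξ x' i))) :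
    hashMap h ξ (x - x') = hashMap h ξ x - hashMap h ξ x' := by
  ext i
  refine Tendsto.limUnder_eq (((hx i).sub (hx' i)).congr fun N => ?_)
  simp only [hashPartialSum, ← Finset.sum_sub_distrib, lp.coeFn_sub, Pi.sub_apply, mul_sub]

/-- Polarization: an error in the inner product forces an error in one of three squared norms. -/
theorem exists_large_of_inner {E F : Type*} [NormedAddCommGroup E] [InnerProductSpace ℝ E]
    [NormedAddCommGroup F] [InnerProductSpace ℝ F] {x x' : E} {y y' : F} {ε : ℝ}
    (h : ε * (‖x‖ ^ 2 + ‖x'‖ ^ 2 + ‖x - x'‖ ^ 2) / 2 < |inner ℝ y y' - inner ℝ x x'|) :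
    ε * ‖x‖ ^ 2 < |‖y‖ ^ 2 - ‖x‖ ^ 2| ∨ ε * ‖x'‖ ^ 2 < |‖y'‖ ^ 2 - ‖x'‖ ^ 2| ∨
      ε * ‖x - x'‖ ^ 2 < |‖y - y'‖ ^ 2 - ‖x - x'‖ ^ 2| := by
  by_contra! hcon
  obtain ⟨h1, h2, h3⟩ := hcon
  rw [abs_le] at h1 h2 h3
  have e1 := norm_sub_sq_real x x'
  have e2 := norm_sub_sq_real y y'
  rcases lt_abs.1 h with h | h <;> linarith

theorem mainTheorem4 :
    ∀ δ₀ : ℝ, 0 < δ₀ → δ₀ < 1 → ∃ C > (0 : ℝ), ∃ c > (0 : ℝ),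
      ∀ (m : ℕ) [NeZero m] (ε δ : ℝ), 0 < ε → ε < 1 → 0 < δ → δ ≤ δ₀ →
      ∀ x x' : lp (fun _ : ℕ => ℝ) 2,
        C * (Real.log (1 / δ) / ε ^ 2) ≤ (m : ℝ) →
        maxRatio x x' ≤ c * (ε / Real.log ((m : ℝ) / δ)) →
        (∀ᵐ p ∂(hashLaw m), ∀ i : Fin m,
          Tendsto (hashPartialSum p.1 p.2 x i) atTop (𝓝 (hashMap p.1 p.2 x i)) ∧
          Tendsto (hashPartialSum p.1 p.2 x' i) atTop (𝓝 (hashMap p.1 p.2 x' i))) ∧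
        (hashLaw m).real
          {p | ε * (‖x‖ ^ 2 + ‖x'‖ ^ 2 + ‖x - x'‖ ^ 2) / 2 <
            |hashInner p.1 p.2 x x' - inner ℝ x x'|} < δ := by
  intro δ₀ hδ₀ hδ₀1
  have hl0 : 0 < Real.log (1 / δ₀) := Real.log_pos (by rw [lt_div_iff₀ hδ₀]; linarith)
  have hl12 : 0 < Real.log 12 := Real.log_pos (by norm_num)
  -- `K` absorbs `log 12`: it satisfies `log (12 t) ≤ K log t` for all `t ≥ 1 / δ₀`.
  set K := 1 + Real.log 12 / Real.log (1 / δ₀) with hK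
  have hK0 : 0 < K := by positivity
  have hlog : ∀ t, 1 / δ₀ ≤ t → 0 < Real.log t ∧ Real.log (12 * t) ≤ K * Real.log t := by
    intro t ht
    have ht0 : 0 < t := lt_of_lt_of_le (by positivity) ht
    have hlt : Real.log (1 / δ₀) ≤ Real.log t := Real.log_le_log (by positivity) ht
    refine ⟨hl0.trans_le hlt, ?_⟩
    rw [Real.log_mul (by norm_num) ht0.ne', hK, add_mul, one_mul, add_comm, div_mul_eq_mul_div]
    gcongr
    rw [le_div_iff₀ hl0]
    gcongr
  refine ⟨64 * K, by positivity, 1 / (6 * K), by positivity, ?_⟩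
  intro m _ ε δ hε hε1 hδ hδδ₀ x x' hm hη
  have hm1 : (1 : ℝ) ≤ m := Nat.one_le_cast.2 (NeZero.pos m)
  have hδ1 : δ < 1 := hδδ₀.trans_lt hδ₀1
  obtain ⟨hlδ, hlδ'⟩ := hlog (1 / δ) (by gcongr)
  obtain ⟨hlm, hlm'⟩ := hlog (m / δ) (by gcongr)
  have hlm'' : 0 < Real.log (12 * m / δ) :=
    Real.log_pos (by rw [lt_div_iff₀ hδ]; linarith)
  rw [mul_one_div] at hlδ'
  rw [← mul_div_assoc] at hlm'
  have hm' : 64 * Real.log (12 / δ) / ε ^ 2 ≤ m := by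
    refine le_trans ?_ hm
    rw [← mul_div_assoc, mul_assoc]
    gcongr
  have hc : 1 / (6 * K) * (ε / Real.log (m / δ)) ≤ ε / (6 * Real.log (12 * m / δ)) := by
    rw [div_mul_div_comm, one_mul, mul_assoc]
    gcongr
  have hbound : ∀ y : lp (fun _ : ℕ => ℝ) 2, supRatio y ≤ maxRatio x x' →
      hashLaw m {p | ε * ‖y‖ ^ 2 < |‖hashMap p.1 p.2 y‖ ^ 2 - ‖y‖ ^ 2|} ≤ ENNReal.ofReal (δ / 4) :=
    fun y hy => hashLaw_norm_tail_le y hε hε1 hδ hδ1 hm'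
      (abs_le_of_supRatio_le y (hy.trans (hη.trans hc)))
  have hx := ae_tendsto_hashPartialSum m x
  have hx' := ae_tendsto_hashPartialSum m x'
  refine ⟨by filter_upwards [hx, hx'] with p h h' i using ⟨h i, h' i⟩, ?_⟩
  -- Three events of probability at most `δ / 4` leave room for the strict inequality.
  refine lt_of_le_of_lt (b := δ / 4 + (δ / 4 + δ / 4)) ?_ (by linarith)
  rw [measureReal_def]
  refine ENNReal.toReal_le_of_le_ofReal (by positivity) ?_
  rw [ENNReal.ofReal_add (by positivity) (by positivity),
    ENNReal.ofReal_add (by positivity) (by positivity)]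
  refine le_trans (measure_mono_ae ?_) ((measure_union_le _ _).trans
    (add_le_add (hbound x (le_max_left _ _)) ((measure_union_le _ _).trans
    (add_le_add (hbound x' ((le_max_left _ _).trans (le_max_right _ _)))
      (hbound (x - x') ((le_max_right _ _).trans (le_max_right _ _)))))))
  filter_upwards [hx, hx'] with p h h' hp
  have hp' := exists_large_of_inner hp
  rwa [← hashMap_sub h h'] at hp'
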